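/- All rings are commutative with $1$. For a ring $R$, $\operatorname{Tot}(R)$ denotes its total ring of fractions; an overring of $R$ is a ring $T$ with $R\subseteq T\subseteq\operatorname{Tot}(R)$ (up to isomorphism over $R$). An ideal of $R$ is regular if it contains a non-zero-divisor of $R$, and an ideal $\mathfrak a$ of $R$ is invertible if $\mathfrak a\mathfrak b=R$ for some $R$-submodule $\mathfrak b$ of $\operatorname{Tot}(R)$. The ring $R$ is called semihereditary if every finitely generated ideal of $R$ is projective; of weak global dimension $\le 1$ if every ideal of $R$ is flat; arithmetical if $\mathfrak a\cap(\mathfrak b+\mathfrak c)=(\mathfrak a\cap\mathfrak b)+(\mathfrak a\cap\mathfrak c)$ for all ideals $\mathfrak a,\mathfrak b,\mathfrak c$ of $R$; Gaussian if $c(f)c(g)=c(fg)$ for all $f,g\in R[X]$, where $c(f)$ is the ideal of $R$ generated by the coefficients of $f$; Prüfer if every finitely generated regular ideal of $R$ is invertible. **Theorem.** Let $\pi\colon B\to T$ be a surjective ring homomorphism, where $T$ is an overring of a ring $R$. Assume that $\ker(\pi)$ is a regular ideal of $B$, and set $A:=\pi^{-1}(R)$, a subring of $B$. 1. $A$ is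 a Prüfer ring if and only if both $B$ and $R$ are Prüfer rings. 2. $A$ is a Gaussian (resp. arithmetical) ring if and only if both $B$ and $R$ are Gaussian (resp. arithmetical) rings. 3. If both $B$ and $R$ have weak global dimension $\le 1$ (resp. are semihereditary), then so does (resp. is) $A$. -/

import Mathlib

/-- An ideal is regular if it contains a regular element (a non-zero-divisor) of the ring. -/
def IsRegularIdeal {R : Type*} [CommRing R] (I : Ideal R) : Prop :=
  ∃ x ∈ I, x ∈ nonZeroDivisors R

/-- An ideal `I` of `R` is invertible if there is an `R`-submodule `J` of the total ring of
fractions of `R` with `I * J = R` inside the total ring of fractions. -/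
def IsInvertibleIdeal {R : Type*} [CommRing R] (I : Ideal R) : Prop :=
  ∃ J : Submodule R (FractionRing R), IsLocalization.coeSubmodule (FractionRing R) I * J = 1

/-- Every finitely generated ideal is projective. -/
def IsSemihereditaryRing (R : Type*) [CommRing R] : Prop :=
  ∀ I : Ideal R, I.FG → Module.Projective R I

/-- Weak global dimension at most one: every ideal is flat. -/
def HasWeakGlobalDimLEOne (R : Type*) [CommRing R] : Prop :=
  ∀ I : Ideal R, Module.Flat R I

/-- The lattice of ideals is distributive. -/
def IsArithmeticalRing (R : Type*) [CommRing R] : Prop :=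
  ∀ I J K : Ideal R, I ⊓ (J ⊔ K) = (I ⊓ J) ⊔ (I ⊓ K)

/-- Content ideals of polynomials are multiplicative. -/
def IsGaussianRing (R : Type*) [CommRing R] : Prop :=
  ∀ f g : Polynomial R, f.contentIdeal * g.contentIdeal = (f * g).contentIdeal

/-- Every finitely generated regular ideal is invertible. -/
def IsPruferRing (R : Type*) [CommRing R] : Prop :=
  ∀ I : Ideal R, I.FG → IsRegularIdeal I → IsInvertibleIdeal I

/-- `T` is an overring of `R`: as an `R`-algebra, `T` is (isomorphic to) a subring, containing
`R`, of the total ring of fractions of `R`. -/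
def IsOverring (R T : Type*) [CommRing R] [CommRing T] [Algebra R T] : Prop :=
  ∃ f : T →ₐ[R] FractionRing R, Function.Injective f

/-!
All five conditions are tested on one elementary notion. A finite family `a` in a ring has local
generators (`HasLocalGenerators {1} a`) if there is a matrix `z` of trace one with
`z i j * a k = z i k * a j` for all `i`, `j`, `k`; where `z i i` is invertible, `a i` generates the
ideal spanned by `a`. A relaxed version requires these identities only up to elements annihilated
by a set `S`. In these terms

* a ring is Prüfer iff every finite family spanning a regular ideal has local generators
  (`isPruferRing_iff`);
* it is arithmetical iff every pair, equivalently every nonempty finite family, has local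
  generators (`isArithmeticalRing_iff`, `IsArithmeticalRing.hasLocalGenerators`);
* it is Gaussian iff every nonempty finite family has local generators modulo its own annihilator
  (`IsGaussianRing.hasLocalGenerators`, `isGaussianRing_of_hasLocalGenerators`). Forwards, over a
  local Gaussian ring the square of an ideal `(a, b)` is generated by `a ^ 2` or `b ^ 2`; backwards,
  the condition reduces the content formula locally to polynomials one of which has a unit
  coefficient, where it follows from McCoy's theorem;
* it has weak global dimension at most one iff it is arithmetical and reduced
  (`hasWeakGlobalDimLEOne_iff`), and it is semihereditary iff it is arithmetical and the
  annihilator of each element is generated by an idempotent (`isSemihereditaryRing_iff`).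

In particular arithmetical and Gaussian rings are Prüfer. The heart of the proof is
`HasLocalGenerators.pullback`: if `R` is Prüfer, then local generators over `B` (also modulo
annihilators) of a family in `A` can be corrected to local generators over `A`. This settles the
passage from `B` and `R` to `A` in the first three cases. Reducedness is inherited by subrings, and
the idempotents of `B` lie in `A` when `R` is semihereditary, because then the overring `T` has no
idempotents outside `R`.

Conversely, a regular element of `ker π` multiplies `B` into `A`, so that families in `B` can be
moved to `A` and the factor cancelled afterwards; and `R` is a quotient of `A`. Only the Prüfer
property does not pass to arbitrary quotients: `isPruferRing_of_surjective` uses that the kernel is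
a regular ideal.
-/

/-! ### Local generators of a finite family -/

/-- The finite family `a` has *local generators modulo the annihilator of `S`*: there is a matrix
`z` of trace one each of whose rows is proportional to `a` up to elements killed by `S`.
Where the diagonal entry `z i i` is invertible, `a i` generates all the `a k` modulo the
annihilator of `S`. For `S = {1}` this says that the ideal generated by `a` is locally principal,
with one of the `a i` as a local generator; an empty family has the property only over the zero
ring. -/
def HasLocalGenerators {R ι : Type*} [CommRing R] [Fintype ι] (S : Set R) (a : ι → R) : Prop :=
  ∃ z : ι → ι → R, ∑ i, z i i = 1 ∧ ∀ i j k, ∀ s ∈ S, (z i j * a k - z i k * a j) * s = 0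

section LocalGenerators

variable {R ι κ : Type*} [CommRing R] [Fintype ι] [Fintype κ]

theorem hasLocalGenerators_one_iff {a : ι → R} :
    HasLocalGenerators {1} a ↔
      ∃ z : ι → ι → R, ∑ i, z i i = 1 ∧ ∀ i j k, z i j * a k = z i k * a j := by
  simp [HasLocalGenerators, sub_eq_zero]

theorem HasLocalGenerators.mono {S S' : Set R} {a : ι → R} (h : HasLocalGenerators S a)
    (hS : S' ⊆ S) : HasLocalGenerators S' a :=
  let ⟨z, h1, h2⟩ := h
  ⟨z, h1, fun i j k s hs => h2 i j k s (hS hs)⟩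

theorem HasLocalGenerators.of_comp_equiv {S : Set R} {a : ι → R} (e : κ ≃ ι)
    (h : HasLocalGenerators S (a ∘ e)) : HasLocalGenerators S a := by
  obtain ⟨z, h1, h2⟩ := h
  refine ⟨fun i j => z (e.symm i) (e.symm j), ?_, fun i j k s hs => ?_⟩
  · rw [← h1]
    exact e.symm.sum_comp (fun i => z i i)
  · simpa using h2 (e.symm i) (e.symm j) (e.symm k) s hs

/-- Local generators may be found one maximal ideal at a time: the rows proportional to `a` form
a submodule, and the values `∑ i, w i i`, for families `w` of such rows, form an ideal. -/
theorem HasLocalGenerators.of_forall_isMaximal {S : Set R} {a : ι → R}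
    (h : ∀ M : Ideal R, M.IsMaximal → ∃ z : ι → R,
      (∀ j k, ∀ s ∈ S, (z j * a k - z k * a j) * s = 0) ∧ ∃ i, z i ∉ M) :
    HasLocalGenerators S a := by
  classical
  let Z : Submodule R (ι → R) :=
    { carrier := {z | ∀ j k, ∀ s ∈ S, (z j * a k - z k * a j) * s = 0}
      zero_mem' := by intro j k s _; simp
      add_mem' := by
        intro x y hx hy j k s hs
        have h1 := hx j k s hs
        have h2 := hy j k s hs
        simp only [Pi.add_apply]
        linear_combination h1 + h2
      smul_mem' := by
        intro c x hx j k s hs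
        have h1 := hx j k s hs
        simp only [Pi.smul_apply, smul_eq_mul]
        linear_combination c * h1 }
  let F : (ι → Z) →ₗ[R] R :=
    ∑ i, (LinearMap.proj i : (ι → R) →ₗ[R] R) ∘ₗ Z.subtype ∘ₗ (LinearMap.proj i)
  have hF : ∀ w, F w = ∑ i, (w i : ι → R) i := by intro w; simp [F]
  have htop : LinearMap.range F = (⊤ : Ideal R) := by
    by_contra hne
    obtain ⟨M, hM, hle⟩ := Ideal.exists_le_maximal _ hne
    obtain ⟨z, hz, i, hi⟩ := h M hM
    refine hi (hle ⟨Pi.single i ⟨z, hz⟩, ?_⟩)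
    rw [hF, Finset.sum_eq_single i]
    · simp
    · intro j _ hj; simp [Pi.single_eq_of_ne hj]
    · simp
  obtain ⟨w, hw⟩ : (1 : R) ∈ LinearMap.range F := by rw [htop]; trivial
  exact ⟨fun i => w i, by rw [← hF, hw], fun i j k s hs => (w i).2 j k s hs⟩

/-- For a pair, local generators amount to `1 ∈ (a : b) + (b : a)`. -/
theorem hasLocalGenerators_pair_iff {a b : R} :
    HasLocalGenerators {1} ![a, b] ↔ ∃ e u v : R, e * b = u * a ∧ (1 - e) * a = v * b := by
  rw [hasLocalGenerators_one_iff]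
  constructor
  · rintro ⟨z, h1, h2⟩
    rw [Fin.sum_univ_two] at h1
    have h3 := h2 0 0 1
    have h4 := h2 1 1 0
    simp only [Matrix.cons_val_zero, Matrix.cons_val_one] at h3 h4
    exact ⟨z 0 0, z 0 1, z 1 0, h3, by rw [← h4, ← h1]; ring⟩
  · rintro ⟨e, u, v, h1, h2⟩
    refine ⟨![![e, u], ![v, 1 - e]], by simp, fun i j k => ?_⟩
    fin_cases i <;> fin_cases j <;> fin_cases k <;> simp [h1, h2]

theorem HasLocalGenerators.map {R' : Type*} [CommRing R'] (f : R →+* R') {a : ι → R}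
    (h : HasLocalGenerators {1} a) : HasLocalGenerators {1} (f ∘ a) := by
  rw [hasLocalGenerators_one_iff] at h ⊢
  obtain ⟨z, h1, h2⟩ := h
  refine ⟨fun i j => f (z i j), by rw [← map_sum, h1, map_one], fun i j k => ?_⟩
  simp only [Function.comp_apply, ← map_mul, h2 i j k]

end LocalGenerators

/-! ### Prüfer rings -/

section Prufer

variable {R : Type*} [CommRing R]

open scoped nonZeroDivisors

theorem HasLocalGenerators.isInvertibleIdeal {ι : Type*} [Fintype ι] {a : ι → R}
    (h : HasLocalGenerators {1} a) (hreg : IsRegularIdeal (Ideal.span (Set.range a))) :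
    IsInvertibleIdeal (Ideal.span (Set.range a)) := by
  obtain ⟨z, h1, h2⟩ := hasLocalGenerators_one_iff.mp h
  obtain ⟨r, hr, hr0⟩ := hreg
  obtain ⟨x, hx⟩ := (Ideal.mem_span_range_iff_exists_fun).mp hr
  let K := FractionRing R
  let i := algebraMap R K
  -- the elements `p j = (∑ l, x l * z j l) / r` satisfy `p j * a k = z j k`
  let p : ι → K := fun j => IsLocalization.mk' K (∑ l, x l * z j l) ⟨r, hr0⟩
  have hp : ∀ j k, i (a k) * p j = i (z j k) := by
    intro j k
    have hq : (∑ l, x l * z j l) * a k = z j k * r := by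
      rw [← hx, Finset.sum_mul, Finset.mul_sum]
      exact Finset.sum_congr rfl fun l _ => by linear_combination x l * h2 j l k
    rw [← IsLocalization.mk'_one (M := R⁰) K (a k), ← IsLocalization.mk'_mul,
      IsLocalization.mk'_eq_iff_eq_mul]
    simp only [one_mul, i, ← map_mul]
    rw [← hq, mul_comm]
  refine ⟨Submodule.span R (Set.range p), le_antisymm ?_ ?_⟩
  · rw [IsLocalization.coeSubmodule_span, Submodule.span_mul_span, Submodule.span_le]
    rintro _ ⟨_, ⟨_, ⟨k, rfl⟩, rfl⟩, _, ⟨j, rfl⟩, rfl⟩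
    exact Submodule.mem_one.mpr ⟨z j k, (hp j k).symm⟩
  · rw [Submodule.one_le]
    have : (1 : K) = ∑ j, i (a j) * p j := by simp_rw [hp, ← map_sum, h1, map_one]
    rw [this]
    refine Submodule.sum_mem _ fun j _ => Submodule.mul_mem_mul ?_ (Submodule.subset_span ⟨j, rfl⟩)
    exact ⟨a j, Ideal.subset_span ⟨j, rfl⟩, rfl⟩

theorem IsInvertibleIdeal.hasLocalGenerators {ι : Type*} [Fintype ι] {a : ι → R}
    (h : IsInvertibleIdeal (Ideal.span (Set.range a))) : HasLocalGenerators {1} a := by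
  obtain ⟨J, hJ⟩ := h
  let K := FractionRing R
  let i := algebraMap R K
  have hi : Function.Injective i := IsFractionRing.injective R K
  have hone : (1 : K) ∈ IsLocalization.coeSubmodule K (Ideal.span (Set.range a)) * J := by
    rw [hJ]; exact Submodule.one_le.mp le_rfl
  have hsum : ∃ p : ι → K, (∀ j, p j ∈ J) ∧ ∑ j, i (a j) * p j = 1 := by
    refine Submodule.mul_induction_on hone ?_ ?_
    · rintro _ ⟨m, hm, rfl⟩ n hn
      obtain ⟨x, rfl⟩ := (Ideal.mem_span_range_iff_exists_fun).mp hm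
      refine ⟨fun j => x j • n, fun j => J.smul_mem _ hn, ?_⟩
      simp only [Algebra.linearMap_apply, map_sum, Finset.sum_mul, map_mul, Algebra.smul_def]
      exact Finset.sum_congr rfl fun j _ => by simp only [i]; ring
    · rintro y y' ⟨p, hp, rfl⟩ ⟨p', hp', rfl⟩
      exact ⟨fun j => p j + p' j, fun j => J.add_mem (hp j) (hp' j), by
        simp [mul_add, Finset.sum_add_distrib]⟩
  obtain ⟨p, hp, hp1⟩ := hsum
  have hmem : ∀ j k, ∃ z, i z = i (a k) * p j := by
    intro j k
    have : i (a k) * p j ∈ (1 : Submodule R K) := by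
      rw [← hJ]
      exact Submodule.mul_mem_mul ⟨a k, Ideal.subset_span ⟨k, rfl⟩, rfl⟩ (hp j)
    exact Submodule.mem_one.mp this
  choose z hz using hmem
  refine hasLocalGenerators_one_iff.mpr ⟨z, hi ?_, fun j k l => hi ?_⟩
  · simp only [map_sum, hz, hp1, map_one]
  · simp only [map_mul, hz]; ring

theorem isPruferRing_iff : IsPruferRing R ↔ ∀ (n : ℕ) (a : Fin n → R),
    IsRegularIdeal (Ideal.span (Set.range a)) → HasLocalGenerators {1} a := by
  constructor
  · intro h n a ha
    exact (h _ (Submodule.fg_span (Set.finite_range a)) ha).hasLocalGenerators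
  · intro h I hI hreg
    obtain ⟨n, a, rfl⟩ := Submodule.fg_iff_exists_fin_generating_family.mp hI
    exact (h n a hreg).isInvertibleIdeal hreg

/-- The zero ideal is regular only in the zero ring, so nonempty families suffice. -/
theorem isPruferRing_of_forall_succ (h : ∀ (n : ℕ) (a : Fin (n + 1) → R),
    IsRegularIdeal (Ideal.span (Set.range a)) → HasLocalGenerators {1} a) : IsPruferRing R := by
  rw [isPruferRing_iff]
  rintro (_ | n) a hreg
  · obtain ⟨x, hx, hx0⟩ := hreg
    obtain rfl : x = 0 := by simpa using hx
    have h10 : (1 : R) = 0 := mem_nonZeroDivisors_iff_right.mp hx0 1 (by simp)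
    exact ⟨fun _ _ => 0, by simp [h10], fun i => i.elim0⟩
  · exact h n a hreg

theorem IsPruferRing.hasLocalGenerators (h : IsPruferRing R) {ι : Type*} [Fintype ι] (a : ι → R)
    (ha : IsRegularIdeal (Ideal.span (Set.range a))) : HasLocalGenerators {1} a := by
  refine .of_comp_equiv (Fintype.equivFin ι).symm (isPruferRing_iff.mp h _ _ ?_)
  rwa [EquivLike.range_comp]

end Prufer

/-! ### Arithmetical rings -/

section Arithmetical

variable {R : Type*} [CommRing R]

theorem isArithmeticalRing_iff :
    IsArithmeticalRing R ↔ ∀ a b : R, HasLocalGenerators {1} ![a, b] := by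
  simp_rw [hasLocalGenerators_pair_iff]
  constructor
  · intro h a b
    have ha : a ∈ Ideal.span {a} ⊓ (Ideal.span {b} ⊔ Ideal.span {a - b}) := by
      refine ⟨Ideal.mem_span_singleton_self a, ?_⟩
      have := Ideal.add_mem _
        (Submodule.mem_sup_left (T := Ideal.span {a - b}) (Ideal.mem_span_singleton_self b))
        (Submodule.mem_sup_right (S := Ideal.span {b}) (Ideal.mem_span_singleton_self (a - b)))
      simpa using this
    rw [h] at ha
    obtain ⟨p, ⟨-, hp⟩, q, ⟨hq', hq⟩, hpq⟩ := Submodule.mem_sup.mp ha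
    obtain ⟨v, hv⟩ := Ideal.mem_span_singleton'.mp hp
    obtain ⟨x, hx⟩ := Ideal.mem_span_singleton'.mp hq'
    obtain ⟨w, hw⟩ := Ideal.mem_span_singleton'.mp hq
    exact ⟨w, w - x, v - w, by linear_combination hx - hw, by linear_combination -hpq - hv - hw⟩
  · intro h I J K
    refine le_antisymm ?_ (sup_le (inf_le_inf_left _ le_sup_left) (inf_le_inf_left _ le_sup_right))
    rintro x ⟨hxI, hx⟩
    obtain ⟨j, hj, k, hk, rfl⟩ := Submodule.mem_sup.mp hx
    obtain ⟨e, u, v, h1, h2⟩ := h j k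
    refine Submodule.mem_sup.mpr ⟨e * (j + k), ⟨I.mul_mem_left _ hxI, ?_⟩,
      (1 - e) * (j + k), ⟨I.mul_mem_left _ hxI, ?_⟩, by ring⟩
    · rw [mul_add, h1, ← add_mul]; exact J.mul_mem_left _ hj
    · rw [mul_add, h2, ← add_mul]; exact K.mul_mem_left _ hk

/-- Over a maximal ideal `M` the relation "`a i` divides `a k` up to a factor outside `M`" is a
total preorder, so a finite family has a local generator. -/
theorem IsArithmeticalRing.hasLocalGenerators (h : IsArithmeticalRing R) {ι : Type*} [Fintype ι]
    [Nonempty ι] (a : ι → R) : HasLocalGenerators {1} a := by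
  classical
  refine .of_forall_isMaximal fun M hM => ?_
  have hprime := hM.isPrime
  let r : ι → ι → Prop := fun k i => ∃ y, y ∉ M ∧ ∃ x, y * a k = x * a i
  have : IsTrans ι r := ⟨by
    rintro i j k ⟨y, hy, x, h1⟩ ⟨y', hy', x', h2⟩
    exact ⟨y' * y, hprime.mul_notMem hy' hy, x * x', by linear_combination y' * h1 + x * h2⟩⟩
  have hrefl : ∀ i, r i i := fun i => ⟨1, hprime.one_notMem, 1, rfl⟩
  have hdir : Directed r (id : ι → ι) := by
    intro i j
    obtain ⟨e, u, v, h1, h2⟩ := hasLocalGenerators_pair_iff.mp (isArithmeticalRing_iff.mp h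
      (a i) (a j))
    by_cases he : e ∈ M
    · refine ⟨j, ⟨1 - e, fun h' => hprime.one_notMem ?_, v, h2⟩, hrefl j⟩
      simpa using M.add_mem h' he
    · exact ⟨i, hrefl i, e, he, u, h1⟩
  obtain ⟨i, hi⟩ := hdir.finite_le (fun k : ι => k)
  choose y hy x hx using hi
  simp only [id] at hx
  -- a common multiplier `Y`, with coefficients `X` such that `X i = Y`
  obtain ⟨Y, hY, X, hXi, hX⟩ : ∃ Y, Y ∉ M ∧ ∃ X : ι → R, X i = Y ∧ ∀ k, Y * a k = X k * a i := by
    refine ⟨∏ l, y l, fun hmem => ?_, Function.update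
      (fun k => (∏ l ∈ Finset.univ.erase k, y l) * x k) i (∏ l, y l), by simp, fun k => ?_⟩
    · obtain ⟨l, -, hl⟩ := (hprime.prod_mem_iff).mp hmem
      exact hy l hl
    · rcases eq_or_ne k i with rfl | hk
      · simp
      · rw [Function.update_of_ne hk, ← Finset.prod_erase_mul _ _ (Finset.mem_univ k), mul_assoc,
          hx, mul_assoc]
  refine ⟨fun k => Y * X k, fun j k s hs => ?_, i, ?_⟩
  · linear_combination s * (X j * hX k - X k * hX j)
  · simpa only [hXi] using hprime.mul_notMem hY hY

theorem IsArithmeticalRing.isPruferRing (h : IsArithmeticalRing R) : IsPruferRing R :=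
  isPruferRing_of_forall_succ fun _ a _ => h.hasLocalGenerators a

end Arithmetical

/-! ### Weak global dimension at most one -/

section WeakGlobalDim

variable {R : Type*} [CommRing R]

/-- Flatness of `(a, b)`, applied to the relation `b • a - a • b = 0`. -/
theorem isArithmeticalRing_of_flat (h : ∀ I : Ideal R, I.FG → Module.Flat R I) :
    IsArithmeticalRing R := by
  refine isArithmeticalRing_iff.mpr fun a b => hasLocalGenerators_pair_iff.mpr ?_
  let I : Ideal R := Ideal.span {a, b}
  have hI : Module.Flat R I := h I (Submodule.fg_span (Set.toFinite _))
  let x : Fin 2 → I :=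
    ![⟨a, Ideal.subset_span (by simp)⟩, ⟨b, Ideal.subset_span (by simp)⟩]
  have hrel : ∑ i, (![b, -a] : Fin 2 → R) i • x i = 0 := by
    apply Subtype.ext
    simp [x, Fin.sum_univ_two, mul_comm]
  obtain ⟨k, c, y, h1, h2⟩ := Module.Flat.isTrivialRelation_of_sum_smul_eq_zero hrel
  have hy : ∀ j, ∃ m n, m * a + n * b = (y j : R) := fun j => Ideal.mem_span_pair.mp (y j).2
  choose m n hmn using hy
  have ha : a = ∑ j, c 0 j * (m j * a + n j * b) := by
    simpa [x, hmn] using congrArg Subtype.val (h1 0)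
  have hc : ∀ j, c 0 j * b = c 1 j * a := by
    intro j
    have := h2 j
    simp only [Fin.sum_univ_two, Matrix.cons_val_zero, Matrix.cons_val_one] at this
    linear_combination this
  refine ⟨∑ j, c 0 j * m j, ∑ j, c 1 j * m j, ∑ j, c 0 j * n j, ?_, ?_⟩
  · simp only [Finset.sum_mul]
    exact Finset.sum_congr rfl fun j _ => by linear_combination m j * hc j
  · have : ∑ j, c 0 j * (m j * a + n j * b) =
        (∑ j, c 0 j * m j) * a + (∑ j, c 0 j * n j) * b := by
      simp only [Finset.sum_mul, ← Finset.sum_add_distrib]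
      exact Finset.sum_congr rfl fun j _ => by ring
    linear_combination ha + this

/-- Flatness of `(x)`, applied to the relation `x • x = 0`. -/
theorem isReduced_of_flat (h : ∀ I : Ideal R, I.FG → Module.Flat R I) : IsReduced R := by
  rw [isReduced_iff_pow_one_lt 2 one_lt_two]
  intro x hx
  have hI : Module.Flat R (Ideal.span {x}) := h _ (Submodule.fg_span (Set.toFinite _))
  have hrel : ∑ i : Fin 1, x • (⟨x, Ideal.mem_span_singleton_self x⟩ : Ideal.span {x}) = 0 := by
    apply Subtype.ext
    simpa [← pow_two] using hx
  obtain ⟨k, c, y, h1, h2⟩ := Module.Flat.isTrivialRelation_of_sum_smul_eq_zero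
    (f := fun _ : Fin 1 => x)
    (x := fun _ : Fin 1 => (⟨x, Ideal.mem_span_singleton_self x⟩ : Ideal.span {x})) hrel
  have hy : ∀ j, ∃ m, m * x = (y j : R) := fun j => Ideal.mem_span_singleton'.mp (y j).2
  choose m hm using hy
  have hx1 : x = ∑ j, c 0 j * (m j * x) := by
    simpa [hm] using congrArg Subtype.val (h1 0)
  rw [hx1]
  refine Finset.sum_eq_zero fun j _ => ?_
  have : x * c 0 j = 0 := by simpa using h2 j
  linear_combination m j * this

/-- In a reduced arithmetical ring the annihilators of two elements with zero product are
comaximal, that is, principal ideals are flat. -/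
theorem IsArithmeticalRing.exists_mul_eq_zero [IsReduced R] (h : IsArithmeticalRing R) {x y : R}
    (hxy : x * y = 0) : ∃ e : R, e * x = 0 ∧ (1 - e) * y = 0 := by
  obtain ⟨e, u, v, h1, h2⟩ := hasLocalGenerators_pair_iff.mp (isArithmeticalRing_iff.mp h y x)
  refine ⟨e, ?_, ?_⟩
  · refine (pow_eq_zero_iff two_ne_zero).mp ?_
    linear_combination e * x * h1 + e * u * hxy
  · refine (pow_eq_zero_iff two_ne_zero).mp ?_
    linear_combination (1 - e) * y * h2 + (1 - e) * v * hxy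

/-- A relation `∑ k, f k * x k = 0` gives `x i * ∑ k, f k * z i k = 0` for a matrix `z` of local
generators of `x`. Elements `e i` and `1 - e i` killing one factor each then yield coefficients
`z i k * (1 - e i)` that make the relation trivial. -/
theorem IsArithmeticalRing.flat [IsReduced R] (h : IsArithmeticalRing R) (I : Ideal R) :
    Module.Flat R I := by
  refine Module.Flat.of_forall_isTrivialRelation ?_
  rintro (_ | l) f x hrel
  · exact ⟨0, fun _ _ => 0, fun _ => 0, fun i => i.elim0, fun j => j.elim0⟩
  obtain ⟨z, hz1, hz⟩ := hasLocalGenerators_one_iff.mp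
    (h.hasLocalGenerators fun k => (x k : R))
  have hrel' : ∑ k, f k * (x k : R) = 0 := by simpa using congrArg Subtype.val hrel
  have hann : ∀ i, (x i : R) * ∑ k, f k * z i k = 0 := by
    intro i
    calc (x i : R) * ∑ k, f k * z i k = z i i * ∑ k, f k * (x k : R) := by
          rw [Finset.mul_sum, Finset.mul_sum]
          exact Finset.sum_congr rfl fun k _ => by linear_combination -f k * hz i i k
      _ = 0 := by rw [hrel', mul_zero]
  choose e he1 he2 using fun i => h.exists_mul_eq_zero (hann i)
  refine ⟨l + 1, fun k i => z i k * (1 - e i), x, fun k => Subtype.ext ?_, fun i => ?_⟩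
  · simp only [Submodule.coe_sum, Submodule.coe_smul, smul_eq_mul]
    calc (x k : R) = (∑ i, z i i) * x k := by rw [hz1, one_mul]
      _ = _ := by
        rw [Finset.sum_mul]
        exact Finset.sum_congr rfl fun i _ => by linear_combination hz i i k + z i k * he1 i
  · rw [← he2 i, Finset.mul_sum]
    exact Finset.sum_congr rfl fun k _ => by ring

theorem hasWeakGlobalDimLEOne_iff :
    HasWeakGlobalDimLEOne R ↔ IsArithmeticalRing R ∧ IsReduced R :=
  ⟨fun h => ⟨isArithmeticalRing_of_flat fun I _ => h I, isReduced_of_flat fun I _ => h I⟩,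
    fun ⟨h, _⟩ => h.flat⟩

end WeakGlobalDim

/-! ### Semihereditary rings -/

section Semihereditary

variable {R : Type*} [CommRing R]

/-- The annihilator of `x` is generated by the idempotent `1 - s x`, for a section `s` of the
map `R → (x)`. -/
theorem IsSemihereditaryRing.exists_idempotent (h : IsSemihereditaryRing R) (x : R) :
    ∃ e : R, IsIdempotentElem e ∧ ∀ z, z * x = 0 ↔ z * e = z := by
  have hproj : Module.Projective R (Ideal.span {x}) := h _ (Submodule.fg_span (Set.toFinite _))
  let x' : Ideal.span {x} := ⟨x, Ideal.mem_span_singleton_self x⟩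
  let p : R →ₗ[R] Ideal.span {x} := LinearMap.toSpanSingleton R _ x'
  have hp : Function.Surjective p := by
    rintro ⟨y, hy⟩
    obtain ⟨m, rfl⟩ := Ideal.mem_span_singleton'.mp hy
    exact ⟨m, Subtype.ext (by simp [p, x'])⟩
  obtain ⟨s, hs⟩ := Module.projective_lifting_property p LinearMap.id hp
  have hx : s x' * x = x := by
    simpa [p, x'] using congrArg Subtype.val (LinearMap.congr_fun hs x')
  have hz : ∀ z, z * x = 0 → z * s x' = 0 := by
    intro z hzx
    have : z • x' = 0 := Subtype.ext (by simpa [x'] using hzx)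
    rw [← smul_eq_mul, ← map_smul, this, map_zero]
  have hidem : (1 - s x') * s x' = 0 := hz _ (by rw [sub_mul, hx, one_mul, sub_self])
  refine ⟨1 - s x', ?_, fun z => ⟨fun h' => ?_, fun h' => ?_⟩⟩
  · unfold IsIdempotentElem; linear_combination -hidem
  · linear_combination -hz z h'
  · linear_combination -x * h' - z * hx

/-- The idempotents split off the annihilators of the generators, so that the rows of a matrix of
local generators become well-defined coordinate functionals: a dual basis. -/
theorem IsArithmeticalRing.isSemihereditaryRing (h : IsArithmeticalRing R)
    (hpp : ∀ x : R, ∃ e : R, IsIdempotentElem e ∧ ∀ z, z * x = 0 ↔ z * e = z) :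
    IsSemihereditaryRing R := by
  intro I hI
  obtain ⟨n, a, rfl⟩ := Submodule.fg_iff_exists_fin_generating_family.mp hI
  obtain ⟨w, hw1, hw2⟩ : ∃ w : Matrix (Fin n) (Fin n) R, (∀ k, ∑ i, w k i * a i = a k) ∧
      ∀ f : Fin n → R, ∑ k, f k * a k = 0 → ∀ i, ∑ k, f k * w k i = 0 := by
    rcases n with _ | n
    · exact ⟨0, fun k => k.elim0, fun f _ i => i.elim0⟩
    obtain ⟨z, hz1, hz⟩ := hasLocalGenerators_one_iff.mp (h.hasLocalGenerators a)
    choose e he1 he2 using fun i => hpp (a i)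
    have hea : ∀ i, e i * a i = 0 := fun i => (he2 i _).mpr (he1 i)
    refine ⟨fun k i => z i k * (1 - e i), fun k => ?_, fun f hf i => ?_⟩
    · calc _ = (∑ i, z i i) * a k := by
            rw [Finset.sum_mul]
            exact Finset.sum_congr rfl fun i _ => by linear_combination -hz i i k - z i k * hea i
        _ = a k := by rw [hz1, one_mul]
    · have hann : (∑ k, f k * z i k) * a i = 0 := by
        calc _ = z i i * ∑ k, f k * a k := by
              rw [Finset.sum_mul, Finset.mul_sum]
              exact Finset.sum_congr rfl fun k _ => by linear_combination -f k * hz i i k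
          _ = 0 := by rw [hf, mul_zero]
      have := (he2 i _).mp hann
      calc _ = (∑ k, f k * z i k) * (1 - e i) := by
            rw [Finset.sum_mul]; exact Finset.sum_congr rfl fun k _ => by ring
        _ = 0 := by linear_combination -this
  let a' : Fin n → Submodule.span R (Set.range a) := fun k => ⟨a k, Submodule.subset_span ⟨k, rfl⟩⟩
  let p : (Fin n → R) →ₗ[R] Submodule.span R (Set.range a) := Fintype.linearCombination R a'
  have hp_apply : ∀ f, (p f : R) = ∑ k, f k * a k := by
    intro f; simp [p, Fintype.linearCombination_apply, a']
  have hp : Function.Surjective p := by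
    rintro ⟨y, hy⟩
    obtain ⟨f, rfl⟩ := (Ideal.mem_span_range_iff_exists_fun).mp hy
    exact ⟨f, Subtype.ext (hp_apply f)⟩
  let m : (Fin n → R) →ₗ[R] (Fin n → R) := Matrix.vecMulLinear w
  have hm_apply : ∀ f i, m f i = ∑ k, f k * w k i := fun f i => rfl
  have hker : LinearMap.ker p ≤ LinearMap.ker m := by
    intro f hf
    rw [LinearMap.mem_ker] at hf ⊢
    have hf' : ∑ k, f k * a k = 0 := by rw [← hp_apply, hf]; rfl
    exact funext fun i => hw2 f hf' i
  refine Module.Projective.of_split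
    ((LinearMap.ker p).liftQ m hker ∘ₗ (p.quotKerEquivOfSurjective hp).symm.toLinearMap) p ?_
  refine LinearMap.ext fun y => ?_
  obtain ⟨f, rfl⟩ := hp y
  have hsymm : (p.quotKerEquivOfSurjective hp).symm (p f) = (LinearMap.ker p).mkQ f := by
    rw [LinearEquiv.symm_apply_eq]; rfl
  apply Subtype.ext
  simp only [LinearMap.comp_apply, LinearEquiv.coe_coe, hsymm, LinearMap.id_apply]
  rw [Submodule.mkQ_apply, Submodule.liftQ_apply, hp_apply, hp_apply]
  simp only [hm_apply, Finset.sum_mul]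
  rw [Finset.sum_comm]
  refine Finset.sum_congr rfl fun k _ => ?_
  conv_rhs => rw [← hw1 k, Finset.mul_sum]
  exact Finset.sum_congr rfl fun i _ => by ring

theorem isSemihereditaryRing_iff : IsSemihereditaryRing R ↔
    IsArithmeticalRing R ∧ ∀ x : R, ∃ e : R, IsIdempotentElem e ∧ ∀ z, z * x = 0 ↔ z * e = z := by
  refine ⟨fun h => ⟨isArithmeticalRing_of_flat fun I hI => ?_, h.exists_idempotent⟩,
    fun ⟨h, hpp⟩ => h.isSemihereditaryRing hpp⟩
  have := h I hI
  infer_instance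

end Semihereditary

/-! ### Gaussian rings -/

section Content

open Polynomial

variable {R : Type*} [CommRing R]

theorem contentIdeal_mul_contentIdeal_le_iff {f g : R[X]} {K : Ideal R} :
    f.contentIdeal * g.contentIdeal ≤ K ↔ ∀ n m, f.coeff n * g.coeff m ∈ K := by
  refine ⟨fun h n m => h (Ideal.mul_mem_mul (f.coeff_mem_contentIdeal n)
    (g.coeff_mem_contentIdeal m)), fun h => ?_⟩
  rw [contentIdeal_def, contentIdeal_def, Ideal.span_mul_span', Ideal.span_le]
  rintro _ ⟨x, hx, y, hy, rfl⟩
  obtain ⟨n, -, rfl⟩ := mem_coeffs_iff.mp hx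
  obtain ⟨m, -, rfl⟩ := mem_coeffs_iff.mp hy
  exact h n m

theorem contentIdeal_le_iff {f : R[X]} {K : Ideal R} :
    f.contentIdeal ≤ K ↔ ∀ n, f.coeff n ∈ K := by
  refine ⟨fun h n => h (f.coeff_mem_contentIdeal n), fun h => ?_⟩
  rw [contentIdeal_def, Ideal.span_le]
  intro x hx
  obtain ⟨n, -, rfl⟩ := mem_coeffs_iff.mp hx
  exact h n

theorem isGaussianRing_iff : IsGaussianRing R ↔
    ∀ (f g : R[X]) (n m : ℕ), f.coeff n * g.coeff m ∈ (f * g).contentIdeal := by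
  refine forall₂_congr fun f g => ?_
  rw [← contentIdeal_mul_contentIdeal_le_iff]
  exact ⟨fun h => h.le, fun h => h.antisymm (contentIdeal_mul_le_mul_contentIdeal f g)⟩

/-- By McCoy's theorem, `p` is not a zero divisor modulo the content of `p * q`. -/
theorem contentIdeal_le_contentIdeal_mul {p : R[X]} (hp : p.contentIdeal = ⊤) (q : R[X]) :
    q.contentIdeal ≤ (p * q).contentIdeal := by
  let J := (p * q).contentIdeal
  let φ := Ideal.Quotient.mk J
  have hpq : p.map φ * q.map φ = 0 := by
    rw [← Polynomial.map_mul, ← contentIdeal_eq_bot_iff, contentIdeal_map_eq_map_contentIdeal,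
      Ideal.map_quotient_self]
  have hnzd : p.map φ ∈ nonZeroDivisors ((R ⧸ J)[X]) := by
    by_contra hcon
    obtain ⟨a, ha, hap⟩ := Polynomial.notMem_nonZeroDivisors_iff.mp hcon
    obtain ⟨b, rfl⟩ := Ideal.Quotient.mk_surjective a
    have hle : p.contentIdeal ≤ Submodule.comap (LinearMap.mulLeft R b) J := by
      rw [contentIdeal_le_iff]
      intro n
      have := congrArg (fun r : (R ⧸ J)[X] => r.coeff n) hap
      simpa [φ, ← map_mul, Ideal.Quotient.eq_zero_iff_mem] using this
    rw [hp] at hle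
    have h1 : b * 1 ∈ J := hle (Submodule.mem_top (x := (1 : R)))
    exact ha (Ideal.Quotient.eq_zero_iff_mem.mpr (by simpa using h1))
  have hq : q.map φ = 0 := mul_left_mem_nonZeroDivisors_eq_zero_iff hnzd |>.mp hpq
  rw [← Ideal.mk_ker (I := (p * q).contentIdeal), ← Ideal.map_eq_bot_iff_le_ker,
    ← contentIdeal_map_eq_map_contentIdeal, contentIdeal_eq_bot_iff]
  exact hq

theorem contentIdeal_eq_of_associated {p q : R[X]} (h : Associated p q) :
    p.contentIdeal = q.contentIdeal :=
  le_antisymm (contentIdeal_le_contentIdeal_of_dvd h.symm.dvd)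
    (contentIdeal_le_contentIdeal_of_dvd h.dvd)

theorem IsGaussianRing.of_surjective {R' : Type*} [CommRing R'] (h : IsGaussianRing R)
    {φ : R →+* R'} (hφ : Function.Surjective φ) : IsGaussianRing R' := by
  intro f g
  obtain ⟨f, rfl⟩ := Polynomial.map_surjective φ hφ f
  obtain ⟨g, rfl⟩ := Polynomial.map_surjective φ hφ g
  simp only [← Polynomial.map_mul, contentIdeal_map_eq_map_contentIdeal, ← Ideal.map_mul, h f g]

theorem IsGaussianRing.of_isLocalization (h : IsGaussianRing R) (M : Submonoid R) (L : Type*)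
    [CommRing L] [Algebra R L] [IsLocalization M L] : IsGaussianRing L := by
  have key : ∀ f : L[X], ∃ F : R[X], Associated f (F.map (algebraMap R L)) := by
    intro f
    obtain ⟨b, hbM, hb⟩ := IsLocalization.integerNormalization_spec M f
    have hu : IsUnit (C (algebraMap R L b)) := (IsLocalization.map_units L ⟨b, hbM⟩).map C
    refine ⟨IsLocalization.integerNormalization M f, hu.unit, ?_⟩
    rw [hb, IsUnit.unit_spec, mul_comm, ← smul_eq_C_mul, algebraMap_smul]
  intro f g
  obtain ⟨F, hF⟩ := key f
  obtain ⟨G, hG⟩ := key g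
  rw [contentIdeal_eq_of_associated hF, contentIdeal_eq_of_associated hG,
    contentIdeal_eq_of_associated (hF.mul_mul hG)]
  simp only [← Polynomial.map_mul, contentIdeal_map_eq_map_contentIdeal, ← Ideal.map_mul, h F G]

end Content

section Gaussian

open Polynomial

variable {R : Type*} [CommRing R]

/-- The Gaussian property for the product of `a X + b` and `c X + d`. -/
theorem IsGaussianRing.mul_mem (h : IsGaussianRing R) {K : Ideal R} {a b c d : R}
    (h2 : a * c ∈ K) (h1 : a * d + b * c ∈ K) (h0 : b * d ∈ K) : a * d ∈ K := by
  have hle : ((C a * X + C b) * (C c * X + C d)).contentIdeal ≤ K := by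
    have : (C a * X + C b) * (C c * X + C d) =
        monomial 2 (a * c) + monomial 1 (a * d + b * c) + monomial 0 (b * d) := by
      simp only [← C_mul_X_pow_eq_monomial, map_mul, map_add]; ring
    rw [this, contentIdeal_le_iff]
    intro n
    simp only [coeff_add, coeff_monomial]
    refine add_mem (add_mem ?_ ?_) ?_ <;> split_ifs <;> first | assumption | exact K.zero_mem
  simpa [coeff_C] using hle (isGaussianRing_iff.mp h (C a * X + C b) (C c * X + C d) 1 0)

/-- In a local Gaussian ring `(a, b) ^ 2` is generated by `a ^ 2` or by `b ^ 2`. -/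
theorem IsGaussianRing.sq_dvd_or_sq_dvd [IsLocalRing R] (h : IsGaussianRing R) (a b : R) :
    (a ^ 2 ∣ b ^ 2 ∧ a ^ 2 ∣ a * b) ∨ (b ^ 2 ∣ a ^ 2 ∧ b ^ 2 ∣ a * b) := by
  obtain ⟨u, v, huv⟩ : ∃ u v, u * a ^ 2 + v * b ^ 2 = a * b := by
    refine Ideal.mem_span_pair.mp (h.mul_mem (b := b) (c := -a) ?_ ?_ ?_)
    · exact Ideal.mem_span_pair.mpr ⟨-1, 0, by ring⟩
    · exact Ideal.mem_span_pair.mpr ⟨0, 0, by ring⟩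
    · exact Ideal.mem_span_pair.mpr ⟨0, 1, by ring⟩
  -- a unit coefficient: multiply `a X - b` by `v a X - (a - v b)`
  have key : ∀ a b u v : R, u * a ^ 2 + v * b ^ 2 = a * b → IsUnit v →
      a ^ 2 ∣ b ^ 2 ∧ a ^ 2 ∣ a * b := by
    intro a b u v huv hv
    have h1 : a * -(a - v * b) ∈ Ideal.span {a ^ 2} := by
      refine h.mul_mem (b := -b) (c := v * a) ?_ ?_ ?_ <;> rw [Ideal.mem_span_singleton']
      · exact ⟨v, by ring⟩
      · exact ⟨-1, by ring⟩
      · exact ⟨u, by linear_combination huv⟩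
    obtain ⟨k, hk⟩ := Ideal.mem_span_singleton'.mp h1
    have hab : a ^ 2 ∣ a * b := by
      refine (hv.dvd_mul_left).mp ⟨k + 1, ?_⟩
      linear_combination -hk
    refine ⟨?_, hab⟩
    refine (hv.dvd_mul_left).mp ?_
    rw [show v * b ^ 2 = a * b - u * a ^ 2 by linear_combination huv]
    exact dvd_sub hab (dvd_mul_left _ _)
  by_cases hv : IsUnit v
  · exact Or.inl (key a b u v huv hv)
  by_cases hu : IsUnit u
  · right
    have := key b a v u (by linear_combination huv) hu
    rwa [mul_comm b a] at this
  -- otherwise compare with `(a X + b) * (b X + a)`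
  obtain ⟨p, q, hpq⟩ : ∃ p q, p * (a * b) + q * (a ^ 2 + b ^ 2) = a * a := by
    refine Ideal.mem_span_pair.mp (h.mul_mem (b := b) (c := b) ?_ ?_ ?_)
    · exact Ideal.mem_span_pair.mpr ⟨1, 0, by ring⟩
    · exact Ideal.mem_span_pair.mpr ⟨0, 1, by ring⟩
    · exact Ideal.mem_span_pair.mpr ⟨1, 0, by ring⟩
  have hrel : (1 - q - p * u) * a ^ 2 = (q + p * v) * b ^ 2 := by
    linear_combination -hpq - p * huv
  have hv' : v ∈ IsLocalRing.maximalIdeal R := hv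
  have hu' : u ∈ IsLocalRing.maximalIdeal R := hu
  by_cases hq : IsUnit (1 - q - p * u)
  · have hdvd : b ^ 2 ∣ a ^ 2 := (hq.dvd_mul_left).mp (hrel ▸ dvd_mul_left _ _)
    refine Or.inr ⟨hdvd, ?_⟩
    rw [← huv]
    exact dvd_add (hdvd.mul_left _) (dvd_mul_left _ _)
  · have hunit : IsUnit (q + p * v) := by
      by_contra hcon
      have h3 : 1 - q - p * u ∈ IsLocalRing.maximalIdeal R := hq
      have h4 : q + p * v ∈ IsLocalRing.maximalIdeal R := hcon
      have h5 := add_mem (add_mem h3 h4)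
        (sub_mem (Ideal.mul_mem_left _ p hu') (Ideal.mul_mem_left _ p hv'))
      refine (Ideal.ne_top_iff_one _).mp (IsLocalRing.maximalIdeal.isMaximal R).ne_top ?_
      convert h5 using 1
      ring
    have hdvd : a ^ 2 ∣ b ^ 2 := (hunit.dvd_mul_left).mp (hrel ▸ dvd_mul_left _ _)
    refine Or.inl ⟨hdvd, ?_⟩
    rw [← huv]
    exact dvd_add (dvd_mul_left _ _) (hdvd.mul_left _)

/-- With `b * b' = t * a ^ 2`, the polynomials `a X + b` and `b' X - t a` have product zero. -/
theorem IsGaussianRing.mul_eq_zero (h : IsGaussianRing R) {a b b' : R} (hb : a * b = 0)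
    (hb' : a * b' = 0) (hdvd : a ^ 2 ∣ b * b') : b * b' = 0 := by
  obtain ⟨t, ht⟩ := hdvd
  have : a * -(t * a) ∈ (⊥ : Ideal R) := by
    refine h.mul_mem (b := b) (c := b') ?_ ?_ ?_ <;> rw [Ideal.mem_bot]
    · exact hb'
    · linear_combination ht
    · linear_combination -t * hb
  rw [Ideal.mem_bot] at this
  linear_combination ht - this

/-- In a local Gaussian ring some member `a i` of a finite family generates the others up to
elements killed by the whole family: take `a i ^ 2` maximal for divisibility, so that it generates
the square of the ideal spanned by `a`. -/
theorem IsGaussianRing.exists_generator [IsLocalRing R] (h : IsGaussianRing R) {ι : Type*}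
    [Finite ι] [Nonempty ι] (a : ι → R) :
    ∃ i, ∃ x : ι → R, x i = 1 ∧ ∀ k l, (a k - x k * a i) * a l = 0 := by
  classical
  let r : ι → ι → Prop := fun k i => a i ^ 2 ∣ a k ^ 2
  have : IsTrans ι r := ⟨fun i j k h1 h2 => dvd_trans h2 h1⟩
  have hdir : Directed r (id : ι → ι) := by
    intro i j
    rcases h.sq_dvd_or_sq_dvd (a i) (a j) with ⟨h1, -⟩ | ⟨h1, -⟩
    · exact ⟨i, dvd_rfl, h1⟩
    · exact ⟨j, h1, dvd_rfl⟩
  obtain ⟨i, hi⟩ := hdir.finite_le (fun k : ι => k)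
  have hdvd : ∀ k, a i ^ 2 ∣ a i * a k := by
    intro k
    rcases h.sq_dvd_or_sq_dvd (a i) (a k) with ⟨-, h1⟩ | ⟨-, h1⟩
    · exact h1
    · exact (hi k).trans h1
  have hx : ∀ k, ∃ x, a i * (a k - x * a i) = 0 ∧ (k = i → x = 1) := by
    intro k
    by_cases hk : k = i
    · exact ⟨1, by rw [hk]; ring, fun _ => rfl⟩
    · obtain ⟨x, hx⟩ := hdvd k
      exact ⟨x, by linear_combination hx, fun h' => absurd h' hk⟩
  choose x hx hx1 using hx
  refine ⟨i, x, hx1 i rfl, fun k l => ?_⟩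
  have hmul : (a k - x k * a i) * (a l - x l * a i) = 0 := by
    refine h.mul_eq_zero (hx k) (hx l) ?_
    have hkl : a i ^ 2 ∣ a k * a l := by
      rcases h.sq_dvd_or_sq_dvd (a k) (a l) with ⟨-, h1⟩ | ⟨-, h1⟩
      · exact (hi k).trans h1
      · exact (hi l).trans h1
    rw [show (a k - x k * a i) * (a l - x l * a i) = a k * a l - x l * (a i * a k)
      - x k * (a i * a l) + a i ^ 2 * (x k * x l) by ring]
    exact dvd_add (dvd_sub (dvd_sub hkl ((hdvd k).mul_left _)) ((hdvd l).mul_left _))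
      (dvd_mul_right _ _)
  linear_combination hmul + x l * hx k

/-- The local generator over the localization at each maximal ideal is spread out by clearing
denominators. -/
theorem IsGaussianRing.hasLocalGenerators (h : IsGaussianRing R) {ι : Type*} [Fintype ι]
    [Nonempty ι] (a : ι → R) : HasLocalGenerators (Set.range a) a := by
  classical
  refine .of_forall_isMaximal fun M hM => ?_
  have hprime := hM.isPrime
  let L := Localization.AtPrime M
  obtain ⟨i, x, hxi, hx⟩ :=
    (h.of_isLocalization M.primeCompl L).exists_generator (algebraMap R L ∘ a)
  -- clear the denominators of the `x k`, then those of the relations between them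
  obtain ⟨b, hb⟩ := IsLocalization.exist_integer_multiples_of_finite M.primeCompl x
  choose X hX using hb
  have hrel : ∀ t : ι × ι × ι, ∃ c : M.primeCompl,
      (c : R) * ((X t.1 * a t.2.1 - X t.2.1 * a t.1) * a t.2.2) = 0 := by
    rintro ⟨j, k, l⟩
    apply (IsLocalization.map_eq_zero_iff M.primeCompl L _).mp
    have h1 := hx k l
    have h2 := hx j l
    simp only [Function.comp_apply] at h1 h2
    simp only [map_mul, map_sub, hX, Algebra.smul_def]
    linear_combination algebraMap R L b * (x j * h1 - x k * h2)
  choose c hc using hrel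
  refine ⟨fun k => (∏ t, (c t : R)) * X k, ?_, i, ?_⟩
  · rintro j k _ ⟨l, rfl⟩
    rw [← Finset.prod_erase_mul _ _ (Finset.mem_univ (j, k, l))]
    linear_combination (∏ t ∈ Finset.univ.erase (j, k, l), (c t : R)) * hc (j, k, l)
  · refine hprime.mul_notMem (fun hmem => ?_) fun hmem => ?_
    · obtain ⟨t, -, ht⟩ := (hprime.prod_mem_iff).mp hmem
      exact (c t).2 ht
    · have hunit : IsUnit (algebraMap R L (X i)) := by
        rw [hX, hxi, Algebra.smul_def, mul_one]
        exact IsLocalization.map_units L b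
      exact (IsLocalization.AtPrime.isUnit_to_map_iff L M _).mp hunit hmem

/-- If `F` or `G` has unit content, then `c(F) c(G) = c(F G)`; this equality passes to `f` and `g`
if products of their coefficients are, up to a unit, those of `α F` and `α G`. -/
theorem coeff_mul_coeff_mem_contentIdeal {f g F G : R[X]} {c α : R} (hc : IsUnit c)
    (h : ∀ n m, c ^ 2 * (f.coeff n * g.coeff m) = α ^ 2 * (F.coeff n * G.coeff m))
    (htop : F.contentIdeal = ⊤ ∨ G.contentIdeal = ⊤) (n m : ℕ) :
    f.coeff n * g.coeff m ∈ (f * g).contentIdeal := by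
  have hFG : F.coeff n * G.coeff m ∈ (F * G).contentIdeal := by
    rcases htop with hF | hG
    · exact Ideal.mul_mem_left _ _
        (contentIdeal_le_contentIdeal_mul hF G (G.coeff_mem_contentIdeal m))
    · rw [mul_comm F]
      exact Ideal.mul_mem_right _ _
        (contentIdeal_le_contentIdeal_mul hG F (F.coeff_mem_contentIdeal n))
  have hle : (F * G).contentIdeal ≤
      Submodule.comap (LinearMap.mulLeft R (α ^ 2)) (f * g).contentIdeal := by
    rw [contentIdeal_le_iff]
    intro k
    have : α ^ 2 * (F * G).coeff k = c ^ 2 * (f * g).coeff k := by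
      simp only [coeff_mul, Finset.mul_sum, h]
    simpa [this] using Ideal.mul_mem_left _ (c ^ 2) ((f * g).coeff_mem_contentIdeal k)
  have hmem : α ^ 2 * (F.coeff n * G.coeff m) ∈ (f * g).contentIdeal := hle hFG
  rw [← h] at hmem
  exact (Ideal.unit_mul_mem_iff_mem _ (hc.pow 2)).mp hmem

/-- Near a maximal ideal some diagonal entry `z i i` is invertible, and the row `z i` provides
polynomials `F` and `G`, one of them with the invertible coefficient `z i i`, such that `f` and
`g` are multiples of them up to coefficients killed by all coefficients of `f` and `g`. -/
theorem isGaussianRing_of_hasLocalGenerators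
    (h : ∀ (n : ℕ) (a : Fin (n + 1) ⊕ Fin (n + 1) → R), HasLocalGenerators (Set.range a) a) :
    IsGaussianRing R := by
  refine isGaussianRing_iff.mpr fun f g m m' => ?_
  let N := max f.natDegree g.natDegree
  let a : Fin (N + 1) ⊕ Fin (N + 1) → R := Sum.elim (fun n => f.coeff n) (fun n => g.coeff n)
  obtain ⟨z, hz1, hz⟩ := h N a
  refine Ideal.mem_of_localization_maximal fun M hM => ?_
  let L := Localization.AtPrime M
  let φ := algebraMap R L
  obtain ⟨i, hi⟩ : ∃ i, z i i ∉ M := by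
    by_contra! hcon
    refine (Ideal.ne_top_iff_one _).mp hM.ne_top ?_
    rw [← hz1]
    exact M.sum_mem fun i _ => hcon i
  have hz' : ∀ k l, (z i i * a k - z i k * a i) * a l = 0 := fun k l => hz i i k _ ⟨l, rfl⟩
  have hunit : IsUnit (φ (z i i)) := (IsLocalization.AtPrime.isUnit_to_map_iff L M _).mpr hi
  let P (w : Fin (N + 1) → R) : R[X] := ∑ n : Fin (N + 1), monomial (n : ℕ) (w n)
  have hP : ∀ w (n : Fin (N + 1)), (P w).coeff n = w n := by
    intro w n
    simp [P, finsetSum_coeff, coeff_monomial, Fin.val_inj]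
  have hP0 : ∀ w (n : ℕ), N < n → (P w).coeff n = 0 := by
    intro w n hn
    simp only [P, finsetSum_coeff, coeff_monomial]
    exact Finset.sum_eq_zero fun k _ => if_neg (by have := k.2; omega)
  let F := P fun n => z i (Sum.inl n)
  let G := P fun n => z i (Sum.inr n)
  have hprod : ∀ n n', z i i ^ 2 * (f.coeff n * g.coeff n') =
      a i ^ 2 * (F.coeff n * G.coeff n') := by
    intro n n'
    by_cases hn : N < n
    · rw [hP0 _ n hn, coeff_eq_zero_of_natDegree_lt (lt_of_le_of_lt (le_max_left _ _) hn)]; ring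
    by_cases hn' : N < n'
    · rw [hP0 _ n' hn', coeff_eq_zero_of_natDegree_lt (lt_of_le_of_lt (le_max_right _ _) hn')]; ring
    have hF := hP (fun n => z i (Sum.inl n)) ⟨n, by omega⟩
    have hG := hP (fun n => z i (Sum.inr n)) ⟨n', by omega⟩
    simp only at hF hG
    rw [hF, hG]
    have h1 := hz' (Sum.inr ⟨n', by omega⟩) (Sum.inl ⟨n, by omega⟩)
    have h2 := hz' (Sum.inl ⟨n, by omega⟩) i
    simp only [a, Sum.elim_inl, Sum.elim_inr] at h1 h2 ⊢
    linear_combination z i i * h1 + z i (Sum.inr ⟨n', by omega⟩) * h2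
  rw [← contentIdeal_map_eq_map_contentIdeal, Polynomial.map_mul, map_mul, ← coeff_map,
    ← coeff_map]
  refine coeff_mul_coeff_mem_contentIdeal (F := F.map φ) (G := G.map φ) (α := φ (a i)) hunit
    (fun n n' => ?_) ?_ m m'
  · simpa only [coeff_map, map_mul, map_pow] using congrArg φ (hprod n n')
  · rcases i with n | n
    · left
      refine Ideal.eq_top_of_isUnit_mem _ (coeff_mem_contentIdeal _ (n : ℕ)) ?_
      rw [coeff_map, hP]; exact hunit
    · right
      refine Ideal.eq_top_of_isUnit_mem _ (coeff_mem_contentIdeal _ (n : ℕ)) ?_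
      rw [coeff_map, hP]; exact hunit

/-- An element killed by a regular ideal vanishes, so in the presence of a regular element local
generators modulo the annihilator of the family are local generators. -/
theorem IsGaussianRing.isPruferRing (h : IsGaussianRing R) : IsPruferRing R := by
  refine isPruferRing_of_forall_succ fun n a ⟨r, hr, hr0⟩ => ?_
  obtain ⟨z, hz1, hz⟩ := h.hasLocalGenerators a
  refine ⟨z, hz1, fun i j k s _ => ?_⟩
  obtain ⟨x, rfl⟩ := (Ideal.mem_span_range_iff_exists_fun).mp hr
  have hzero : (z i j * a k - z i k * a j) * ∑ l, x l * a l = 0 := by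
    rw [Finset.mul_sum]
    exact Finset.sum_eq_zero fun l _ => by linear_combination x l * hz i j k _ ⟨l, rfl⟩
  rw [mem_nonZeroDivisors_iff_right.mp hr0 _ hzero, zero_mul]

end Gaussian

/-! ### Overrings -/

section Overring

variable {R T : Type*} [CommRing R] [CommRing T] [Algebra R T]

open scoped nonZeroDivisors

theorem IsOverring.algebraMap_injective (hT : IsOverring R T) :
    Function.Injective (algebraMap R T) := by
  obtain ⟨f, -⟩ := hT
  refine Function.Injective.of_comp (f := f) ?_
  have : (f : T → FractionRing R) ∘ algebraMap R T = algebraMap R (FractionRing R) :=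
    funext fun r => f.commutes r
  rw [this]
  exact IsFractionRing.injective R _

theorem IsOverring.mul_left_cancel (hT : IsOverring R T) {d : R} (hd : d ∈ R⁰) {x y : T}
    (h : algebraMap R T d * x = algebraMap R T d * y) : x = y := by
  obtain ⟨f, hf⟩ := hT
  have hu : IsUnit (algebraMap R (FractionRing R) d) :=
    IsLocalization.map_units (FractionRing R) (⟨d, hd⟩ : R⁰)
  refine hf (hu.mul_left_cancel ?_)
  simpa using congrArg f h

theorem IsOverring.exists_common_denominator (hT : IsOverring R T) {ι : Type*} [Finite ι]
    (t : ι → T) : ∃ d ∈ R⁰, ∃ r : ι → R, ∀ i, algebraMap R T (r i) = algebraMap R T d * t i := by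
  obtain ⟨f, hf⟩ := hT
  obtain ⟨d, hd⟩ := IsLocalization.exist_integer_multiples_of_finite R⁰ (f ∘ t)
  choose r hr using hd
  refine ⟨d, d.2, r, fun i => hf ?_⟩
  rw [f.commutes, hr, map_mul, f.commutes, Algebra.smul_def]
  rfl

/-- Write `t = r / d` and let the idempotent `e` generate the annihilator of `r`; then
`1 - t = e`. -/
theorem IsOverring.exists_algebraMap_eq_of_isIdempotentElem (hT : IsOverring R T)
    (hpp : ∀ x : R, ∃ e : R, IsIdempotentElem e ∧ ∀ z, z * x = 0 ↔ z * e = z)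
    {t : T} (ht : IsIdempotentElem t) : ∃ r, algebraMap R T r = t := by
  obtain ⟨d, hd, r, hr⟩ := hT.exists_common_denominator fun _ : Unit => t
  replace hr := hr ()
  obtain ⟨e, he, hann⟩ := hpp (r ())
  have h1 : (d - r ()) * e = d - r () := by
    refine (hann _).mp (hT.algebraMap_injective ?_)
    rw [map_mul, map_sub, map_zero, hr]
    linear_combination -algebraMap R T d ^ 2 * ht.eq
  have h2 : (1 - t) * algebraMap R T e = 1 - t := by
    refine hT.mul_left_cancel hd ?_
    have := congrArg (algebraMap R T) h1
    rw [map_mul, map_sub, hr] at this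
    linear_combination this
  have h3 : t * algebraMap R T e = 0 := by
    refine hT.mul_left_cancel hd ?_
    have := congrArg (algebraMap R T) ((hann e).mpr he)
    rw [map_mul, hr, map_zero] at this
    linear_combination this
  exact ⟨1 - e, by rw [map_sub, map_one]; linear_combination -h2 - h3⟩

end Overring

/-! ### The pullback ring -/

section Pullback

variable {B R T : Type*} [CommRing B] [CommRing R] [CommRing T] [Algebra R T] {π : B →+* T}
  {A : Subring B} {ι : Type*} [Fintype ι]

open scoped nonZeroDivisors

/-- Local generators over `B` of a family in the pullback `A = π⁻¹(R)` can be corrected to local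
generators over `A`, provided that `R` is a Prüfer ring. If `z` is the matrix over `B`, the entries
of `π z` generate a fractional ideal of `R` containing `1`, hence invertible; lifts of elements of
its inverse multiply the rows of `z` into `A`. The resulting trace is `1 + c` with `c ∈ ker π`, and
the error is removed by subtracting `c * z`, whose entries lie in `ker π ⊆ A`. -/
theorem HasLocalGenerators.pullback (hT : IsOverring R T) (hR : IsPruferRing R)
    (hπ : Function.Surjective π) (hA : ∀ b, b ∈ A ↔ ∃ r, algebraMap R T r = π b)
    {S : Set A} {a : ι → A}
    (h : HasLocalGenerators (Subtype.val '' S) (fun i => (a i : B))) :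
    HasLocalGenerators S a := by
  obtain ⟨z, hz1, hz⟩ := h
  let i := algebraMap R T
  obtain ⟨d, hd, r, hr⟩ := hT.exists_common_denominator fun p : ι × ι => π (z p.1 p.2)
  have htrace : ∑ m, π (z m m) = 1 := by rw [← map_sum, hz1, map_one]
  have hdr : ∑ m, r (m, m) = d := by
    apply hT.algebraMap_injective
    simp only [map_sum, hr]
    rw [← Finset.mul_sum, htrace, mul_one]
  have hreg : IsRegularIdeal (Ideal.span (Set.range r)) := by
    refine ⟨d, ?_, hd⟩
    rw [← hdr]
    exact Ideal.sum_mem _ fun m _ => Ideal.subset_span ⟨(m, m), rfl⟩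
  obtain ⟨w, hw1, hw⟩ := hasLocalGenerators_one_iff.mp (hR.hasLocalGenerators r hreg)
  -- the elements `∑ m, w p (m, m)` span the inverse of the fractional ideal of the `π (z j k)`
  have hinv : ∀ p s : ι × ι, i (∑ m, w p (m, m)) * π (z s.1 s.2) = i (w p s) := by
    intro p s
    refine hT.mul_left_cancel hd ?_
    calc i d * (i (∑ m, w p (m, m)) * π (z s.1 s.2)) = i (∑ m, w p (m, m)) * i (r s) := by
          rw [hr]; ring
      _ = i (w p s * ∑ m, r (m, m)) := by
          rw [← map_mul, Finset.sum_mul, Finset.mul_sum]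
          exact congrArg i (Finset.sum_congr rfl fun m _ => hw p (m, m) s)
      _ = i d * i (w p s) := by rw [hdr, map_mul, mul_comm]
  choose β hβ using fun p : ι × ι => hπ (i (∑ m, w p (m, m)))
  let y : ι → ι → B := fun j k => ∑ l, β (l, j) * z l k
  have hy : ∀ j k, π (y j k) = i (∑ l, w (l, j) (l, k)) := by
    intro j k
    simp only [y, map_sum π, map_mul, hβ]
    rw [map_sum i]
    exact Finset.sum_congr rfl fun l _ => hinv (l, j) (l, k)
  let c : B := ∑ j, y j j - 1
  have hc : π c = 0 := by
    simp only [c, map_sub, map_sum π, hy, map_one]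
    rw [← map_sum i, Finset.sum_comm, ← Fintype.sum_prod_type' (fun l j => w (l, j) (l, j))]
    simp only [Prod.mk.eta, hw1, i, map_one, sub_self]
  have hmem : ∀ j k, y j k - c * z j k ∈ A := by
    intro j k
    refine (hA _).mpr ⟨∑ l, w (l, j) (l, k), ?_⟩
    rw [map_sub π, map_mul π, hc, zero_mul, sub_zero, hy]
  refine ⟨fun j k => ⟨_, hmem j k⟩, Subtype.ext ?_, fun j k l s hs => Subtype.ext ?_⟩
  · simp only [AddSubmonoidClass.coe_finsetSum, OneMemClass.coe_one, Finset.sum_sub_distrib]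
    rw [← Finset.mul_sum, hz1]
    simp only [c]; ring
  · have hz' : ∀ m, (z m k * a l - z m l * a k) * (s : B) = 0 := fun m =>
      hz m k l s ⟨s, hs, rfl⟩
    have hy' : (y j k * a l - y j l * a k) * (s : B) = 0 := by
      simp only [y, Finset.sum_mul, ← Finset.sum_sub_distrib]
      exact Finset.sum_eq_zero fun m _ => by linear_combination β (m, j) * hz' m
    push_cast
    linear_combination hy' - c * hz' j

theorem HasLocalGenerators.pullback_one (hT : IsOverring R T) (hR : IsPruferRing R)
    (hπ : Function.Surjective π) (hA : ∀ b, b ∈ A ↔ ∃ r, algebraMap R T r = π b) {a : ι → A}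
    (h : HasLocalGenerators {1} (fun i => (a i : B))) : HasLocalGenerators {1} a :=
  .pullback hT hR hπ hA (by simpa using h)

/-- Local generators over a subring of a family multiplied by a regular element are local
generators of the original family. -/
theorem HasLocalGenerators.of_mul_regular {s : B} (hs : s ∈ B⁰) {S : Set A} {S' : Set B}
    (hS : ∀ t ∈ S', ∃ m ∈ B⁰, ∃ u ∈ S, (u : B) = m * t) {a' : ι → A} {a : ι → B}
    (ha : ∀ i, (a' i : B) = s * a i) (h : HasLocalGenerators S a') :
    HasLocalGenerators S' a := by
  obtain ⟨z, h1, h2⟩ := h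
  refine ⟨fun i j => z i j, by simpa using congrArg Subtype.val h1, fun i j k t ht => ?_⟩
  obtain ⟨m, hm, u, hu, hut⟩ := hS t ht
  refine mul_left_mem_nonZeroDivisors_eq_zero_iff (mul_mem hs hm) |>.mp ?_
  have := congrArg Subtype.val (h2 i j k u hu)
  push_cast [ha, hut] at this
  linear_combination this

variable {s : B}

theorem isPruferRing_of_subring (hs : s ∈ B⁰) (hsA : ∀ b, s * b ∈ A) (h : IsPruferRing A) :
    IsPruferRing B := by
  rw [isPruferRing_iff]
  rintro n a ⟨r, hr, hr0⟩
  refine .of_mul_regular (A := A) hs (S := {1}) ?_ (a' := fun i => ⟨s * a i, hsA _⟩) (fun i => rfl)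
    (h.hasLocalGenerators _ ?_)
  · rintro _ rfl
    exact ⟨1, one_mem _, 1, rfl, by simp⟩
  · obtain ⟨x, rfl⟩ := (Ideal.mem_span_range_iff_exists_fun).mp hr
    let r' : A := ∑ i, ⟨s * x i, hsA _⟩ * ⟨s * a i, hsA _⟩
    have hr' : (r' : B) = s * s * ∑ i, x i * a i := by
      simp only [r', AddSubmonoidClass.coe_finsetSum, MulMemClass.coe_mul, Finset.mul_sum]
      exact Finset.sum_congr rfl fun i _ => by ring
    refine ⟨r', Ideal.sum_mem _ fun i _ => Ideal.mul_mem_left _ _ (Ideal.subset_span ⟨i, rfl⟩), ?_⟩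
    refine mem_nonZeroDivisors_of_injective (f := A.subtype) Subtype.val_injective ?_
    rw [Subring.subtype_apply, hr']
    exact mul_mem (mul_mem hs hs) hr0

theorem isArithmeticalRing_of_subring (hs : s ∈ B⁰) (hsA : ∀ b, s * b ∈ A)
    (h : IsArithmeticalRing A) : IsArithmeticalRing B := by
  refine isArithmeticalRing_iff.mpr fun x y => ?_
  refine .of_mul_regular (A := A) hs (S := {1}) ?_ (a' := fun i => ⟨s * ![x, y] i, hsA _⟩)
    (fun i => rfl) (h.hasLocalGenerators _)
  rintro _ rfl
  exact ⟨1, one_mem _, 1, rfl, by simp⟩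

theorem isGaussianRing_of_subring (hs : s ∈ B⁰) (hsA : ∀ b, s * b ∈ A)
    (h : IsGaussianRing A) : IsGaussianRing B := by
  refine isGaussianRing_of_hasLocalGenerators fun n a => ?_
  refine .of_mul_regular (A := A) hs ?_ (a' := fun i => ⟨s * a i, hsA _⟩)
    (fun i => rfl) (h.hasLocalGenerators _)
  rintro _ ⟨i, rfl⟩
  exact ⟨s, hs, _, ⟨i, rfl⟩, rfl⟩

theorem isArithmeticalRing_of_surjective {R' : Type*} [CommRing R'] {φ : R' →+* R}
    (hφ : Function.Surjective φ) (h : IsArithmeticalRing R') : IsArithmeticalRing R := by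
  refine isArithmeticalRing_iff.mpr fun x y => ?_
  obtain ⟨x, rfl⟩ := hφ x
  obtain ⟨y, rfl⟩ := hφ y
  have := (isArithmeticalRing_iff.mp h x y).map φ
  convert this using 1
  ext i
  fin_cases i <;> rfl

/-- A family of the quotient generating a regular ideal is lifted together with a regular element
of the kernel; the diagonal entry at that element maps to an element killed by the family, hence to
zero. -/
theorem isPruferRing_of_surjective {R' : Type*} [CommRing R'] {φ : R' →+* R}
    (hφ : Function.Surjective φ) (hker : IsRegularIdeal (RingHom.ker φ)) (h : IsPruferRing R') :
    IsPruferRing R := by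
  obtain ⟨s, hs, hs0⟩ := hker
  rw [isPruferRing_iff]
  rintro n a ⟨r, hr, hr0⟩
  choose a' ha' using fun i => hφ (a i)
  let b : Option (Fin n) → R' := fun o => o.elim s a'
  obtain ⟨z, hz1, hz⟩ := hasLocalGenerators_one_iff.mp
    (h.hasLocalGenerators b ⟨s, Ideal.subset_span ⟨none, rfl⟩, hs0⟩)
  have hz' : ∀ o i j, φ (z o (some i)) * a j = φ (z o (some j)) * a i := by
    intro o i j
    rw [← ha', ← ha', ← map_mul, ← map_mul]
    exact congrArg φ (hz o (some i) (some j))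
  have hnone : φ (z none none) = 0 := by
    obtain ⟨x, rfl⟩ := (Ideal.mem_span_range_iff_exists_fun).mp hr
    refine mem_nonZeroDivisors_iff_right.mp hr0 _ ?_
    rw [Finset.mul_sum]
    refine Finset.sum_eq_zero fun l _ => ?_
    have h0 : φ (z none none * a' l) = φ (z none (some l) * s) :=
      congrArg φ (hz none none (some l))
    rw [map_mul, map_mul, ha', (RingHom.mem_ker).mp hs, mul_zero] at h0
    linear_combination x l * h0
  refine hasLocalGenerators_one_iff.mpr ⟨fun i j => φ (z (some i) (some j)), ?_, fun i j k =>
    hz' (some i) j k⟩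
  have := congrArg φ hz1
  rwa [Fintype.sum_option, map_add, hnone, zero_add, map_sum, map_one] at this

end Pullback

theorem mainTheorem1 {B R T : Type*} [CommRing B] [CommRing R] [CommRing T] [Algebra R T]
    (hT : IsOverring R T) (π : B →+* T) (hπ : Function.Surjective π)
    (hker : IsRegularIdeal (RingHom.ker π))
    (A : Subring B) (hA : A = (algebraMap R T).range.comap π) :
    (IsPruferRing A ↔ IsPruferRing B ∧ IsPruferRing R) ∧
    (IsGaussianRing A ↔ IsGaussianRing B ∧ IsGaussianRing R) ∧
    (IsArithmeticalRing A ↔ IsArithmeticalRing B ∧ IsArithmeticalRing R) ∧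
    (HasWeakGlobalDimLEOne B ∧ HasWeakGlobalDimLEOne R → HasWeakGlobalDimLEOne A) ∧
    (IsSemihereditaryRing B ∧ IsSemihereditaryRing R → IsSemihereditaryRing A) := by
  have hmem : ∀ b, b ∈ A ↔ ∃ r, algebraMap R T r = π b := by
    intro b
    rw [hA, Subring.mem_comap, RingHom.mem_range]
  obtain ⟨s, hsker, hs⟩ := hker
  have hsA : ∀ b, s * b ∈ A := fun b =>
    (hmem _).mpr ⟨0, by rw [map_mul, (RingHom.mem_ker).mp hsker, zero_mul, map_zero]⟩
  -- the restriction of `π` to `A`, with values in `R`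
  obtain ⟨φ, hφ⟩ : ∃ φ : A →+* R, ∀ a, algebraMap R T (φ a) = π a := by
    let e := RingEquiv.ofBijective (algebraMap R T).rangeRestrict
      ⟨fun x y hxy => hT.algebraMap_injective (congrArg Subtype.val hxy),
        (algebraMap R T).rangeRestrict_surjective⟩
    refine ⟨e.symm.toRingHom.comp ((π.comp A.subtype).codRestrict (algebraMap R T).range
      fun a => (hmem _).mp a.2), fun a => ?_⟩
    exact congrArg Subtype.val (e.apply_symm_apply ⟨π a, (hmem _).mp a.2⟩)
  have hφs : Function.Surjective φ := by
    intro r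
    obtain ⟨b, hb⟩ := hπ (algebraMap R T r)
    exact ⟨⟨b, (hmem b).mpr ⟨r, hb.symm⟩⟩, hT.algebraMap_injective (by rw [hφ, hb])⟩
  have hφker : IsRegularIdeal (RingHom.ker φ) := by
    refine ⟨⟨s, by simpa using hsA 1⟩, hT.algebraMap_injective ?_,
      mem_nonZeroDivisors_of_injective (f := A.subtype) Subtype.val_injective hs⟩
    rw [hφ, map_zero]
    exact hsker
  have harith : IsArithmeticalRing B → IsArithmeticalRing R → IsArithmeticalRing A :=
    fun hB hR => isArithmeticalRing_iff.mpr fun x y =>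
      .pullback_one hT hR.isPruferRing hπ hmem (hB.hasLocalGenerators _)
  refine ⟨⟨fun h => ⟨isPruferRing_of_subring hs hsA h, isPruferRing_of_surjective hφs hφker h⟩, ?_⟩,
    ⟨fun h => ⟨isGaussianRing_of_subring hs hsA h, h.of_surjective hφs⟩, ?_⟩,
    ⟨fun h => ⟨isArithmeticalRing_of_subring hs hsA h, isArithmeticalRing_of_surjective hφs h⟩,
      fun h => harith h.1 h.2⟩, ?_, ?_⟩
  · rintro ⟨hB, hR⟩
    rw [isPruferRing_iff]
    rintro n a ⟨r, hr, hr0⟩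
    refine .pullback_one hT hR hπ hmem (hB.hasLocalGenerators _ ?_)
    -- a regular element `r` of `A` stays regular in `B`, because `s * b ∈ A` for `b` in `B`
    refine ⟨r, ?_, mem_nonZeroDivisors_iff_right.mpr fun b hb => ?_⟩
    · obtain ⟨x, rfl⟩ := (Ideal.mem_span_range_iff_exists_fun).mp hr
      push_cast
      exact Ideal.sum_mem _ fun i _ => Ideal.mul_mem_left _ _ (Ideal.subset_span ⟨i, rfl⟩)
    · have h0 : (⟨s * b, hsA b⟩ : A) = 0 := by
        refine mem_nonZeroDivisors_iff_right.mp hr0 _ (Subtype.ext ?_)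
        push_cast
        linear_combination s * hb
      exact mem_nonZeroDivisors_iff.mp hs |>.1 b (congrArg Subtype.val h0)
  · rintro ⟨hB, hR⟩
    refine isGaussianRing_of_hasLocalGenerators fun n a =>
      .pullback hT hR.isPruferRing hπ hmem ((hB.hasLocalGenerators _).mono ?_)
    rintro _ ⟨_, ⟨i, rfl⟩, rfl⟩
    exact ⟨i, rfl⟩
  · simp only [hasWeakGlobalDimLEOne_iff]
    rintro ⟨⟨hB, _⟩, hR, -⟩
    exact ⟨harith hB hR, isReduced_of_injective A.subtype Subtype.val_injective⟩
  · simp only [isSemihereditaryRing_iff]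
    rintro ⟨⟨hB, hBpp⟩, hR, hRpp⟩
    refine ⟨harith hB hR, fun x => ?_⟩
    -- the idempotent of `B` belonging to `x` lies in `A`, as idempotents of `T` come from `R`
    obtain ⟨e, he, hann⟩ := hBpp x
    have heA : e ∈ A :=
      (hmem e).mpr (hT.exists_algebraMap_eq_of_isIdempotentElem hRpp (he.map π))
    refine ⟨⟨e, heA⟩, Subtype.ext he, fun z => ?_⟩
    simpa [Subtype.ext_iff] using hann z
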